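/- Let $A_1$ and $A_2$ be reduced abelian groups whose basic subgroups are countable, i.e. for every prime $p$ each $A_i$ has an at most countable $p$-basic subgroup. (A $p$-basic subgroup of $A$ is a pure subgroup $B$ which is a direct sum of infinite cyclic groups and cyclic $p$-groups and for which $A/B$ is $p$-divisible. If $A$ is a $p$-group, then $0$ is its only $q$-basic subgroup for primes $q\neq p$, so that the condition says that $A$ has an at most countable basic subgroup in the usual sense.) Let $\mathrm{Th}_2^{\omega}(A)$ be the set of all sentences of the second order language of groups (with the ternary relation symbol $x_1=x_2+x_3$, object variables, and $l$-place predicate variables for all $l\geq 1$) which are true in $A$ when object variables range over $A$ and $l$-place predicate variables range over the subsets of $A^l$ of cardinality at most $\omega$. If $\mathrm{Th}_2^{\omega}(A_1)=\mathrm{Th}_2^{\omega}(A_2)$, then the endomorphism rings $\mathrm{End}(A_1)$ and $\mathrm{End}(A_2)$ are elementarily equivalent, i.e. they satisfy the same first order sentences in the ring language with the ternary relation symbols $x_1=x_2+x_3$ and $x_1=x_2\cdot x_3$. -/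

import Mathlib

open scoped Cardinal

/-! ### Abelian groups -/

/-- A subgroup `D` is divisible (as a group) if every element of `D` is, for every positive
integer `n`, an `n`-th multiple of an element of `D`. -/
def IsDivisibleSubgroup {A : Type*} [AddCommGroup A] (D : AddSubgroup A) : Prop :=
  ∀ n : ℕ, 0 < n → ∀ a ∈ D, ∃ x ∈ D, n • x = a

/-- An abelian group is reduced if it has no nonzero divisible subgroup. -/
def IsReducedGroup (A : Type*) [AddCommGroup A] : Prop :=
  ∀ D : AddSubgroup A, IsDivisibleSubgroup D → D = ⊥

/-- A subgroup `B` is pure in `A` if an equation `n x = g` with `g ∈ B` is solvable in `B`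
whenever it is solvable in `A`. -/
def IsPureSubgroup {A : Type*} [AddCommGroup A] (B : AddSubgroup A) : Prop :=
  ∀ n : ℤ, ∀ g ∈ B, (∃ x : A, n • x = g) → ∃ y ∈ B, n • y = g

/-- `B` is the (internal) direct sum of a family of subgroups each of which is an infinite cyclic
group or a cyclic `p`-group. -/
def IsDirectSumOfCyclics {A : Type*} [AddCommGroup A] (p : ℕ) (B : AddSubgroup A) : Prop :=
  ∃ S : Set (AddSubgroup A), sSupIndep S ∧ sSup S = B ∧
    ∀ C ∈ S, IsAddCyclic C ∧ (Infinite C ∨ ∃ k : ℕ, Nat.card C = p ^ k)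

/-- `p`-basic subgroups of an abelian group. -/
structure IsBasicSubgroup {A : Type*} [AddCommGroup A] (p : ℕ) (B : AddSubgroup A) : Prop where
  directSum : IsDirectSumOfCyclics p B
  pure : IsPureSubgroup B
  divisible : ∀ x : A ⧸ B, ∃ y : A ⧸ B, p • y = x

/-- For every prime `p` the group has an (at most) countable `p`-basic subgroup. For a `p`-group
this says that it has a countable basic subgroup, see `hasCountableBasicSubgroups_iff`. -/
def HasCountableBasicSubgroups (A : Type*) [AddCommGroup A] : Prop :=
  ∀ p : ℕ, p.Prime → ∃ B : AddSubgroup A, IsBasicSubgroup p B ∧ (B : Set A).Countable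

/-- In a `p`-group only the prime `p` matters: for a prime `q ≠ p` the zero subgroup is
`q`-basic. -/
theorem hasCountableBasicSubgroups_iff {A : Type*} [AddCommGroup A] {p : ℕ} (hp : p.Prime)
    (hA : ∀ a : A, ∃ k : ℕ, p ^ k • a = 0) :
    HasCountableBasicSubgroups A ↔
      ∃ B : AddSubgroup A, IsBasicSubgroup p B ∧ (B : Set A).Countable := by
  refine ⟨fun h => h p hp, fun h q hq => ?_⟩
  by_cases hqp : q = p
  · exact hqp ▸ h
  refine ⟨⊥, ⟨⟨∅, ?_, by simp, by simp⟩, ?_, ?_⟩, by simp⟩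
  · simp
  · intro n g hg _
    exact ⟨0, zero_mem _, by simpa using ((AddSubgroup.mem_bot).1 hg).symm⟩
  · intro x
    obtain ⟨a, rfl⟩ := QuotientAddGroup.mk_surjective x
    obtain ⟨k, hk⟩ := hA a
    have hc : IsCoprime (q : ℤ) ((p ^ k : ℕ) : ℤ) :=
      Nat.isCoprime_iff_coprime.2 (((Nat.coprime_primes hq hp).2 hqp).pow_right k)
    obtain ⟨u, v, huv⟩ := hc
    refine ⟨QuotientAddGroup.mk (u • a), ?_⟩
    rw [← QuotientAddGroup.mk_nsmul]
    congr 1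
    have h1 : (u * (q : ℤ) + v * ((p ^ k : ℕ) : ℤ)) • a = a := by rw [huv, one_smul]
    rw [add_smul, mul_smul, mul_smul, natCast_zsmul, natCast_zsmul, hk, smul_zero, add_zero] at h1
    rw [smul_comm]
    exact h1

/-! ### The second order language of abelian groups -/

/-- Formulas of the second order group language. Object variables `x_i` are indexed by `i : ℕ`;
predicate variables are indexed by pairs `(l, i)`, where `l + 1` is the number of places (so the
number of places is at least one). The only relation symbol is the three-place symbol of
addition. -/
inductive SOFormula : Type
  /-- `x_i = x_j` -/
  | eq (i j : ℕ) : SOFormula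
  /-- `x_i = x_j + x_k` -/
  | add (i j k : ℕ) : SOFormula
  /-- `P(x_{t 0}, …, x_{t l})`, where `P` is the predicate variable `(l, i)` -/
  | pred (l i : ℕ) (t : Fin (l + 1) → ℕ) : SOFormula
  | neg (φ : SOFormula) : SOFormula
  | and (φ ψ : SOFormula) : SOFormula
  /-- `∀ x_i φ` -/
  | all (i : ℕ) (φ : SOFormula) : SOFormula
  /-- `∀ P(v_0, …, v_l) φ`, where `P` is the predicate variable `(l, i)` -/
  | allPred (l i : ℕ) (φ : SOFormula) : SOFormula

namespace SOFormula

/-- The free object variables. -/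
def freeVar : SOFormula → Finset ℕ
  | eq i j => {i, j}
  | add i j k => {i, j, k}
  | pred _ _ t => Finset.univ.image t
  | neg φ => φ.freeVar
  | and φ ψ => φ.freeVar ∪ ψ.freeVar
  | all i φ => φ.freeVar.erase i
  | allPred _ _ φ => φ.freeVar

/-- The free predicate variables. -/
def freePred : SOFormula → Finset (ℕ × ℕ)
  | eq _ _ => ∅
  | add _ _ _ => ∅
  | pred l i _ => {(l, i)}
  | neg φ => φ.freePred
  | and φ ψ => φ.freePred ∪ ψ.freePred
  | all _ φ => φ.freePred
  | allPred l i φ => φ.freePred.erase (l, i)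

/-- A sentence is a formula without free object and predicate variables. -/
def IsSentence (φ : SOFormula) : Prop :=
  φ.freeVar = ∅ ∧ φ.freePred = ∅

/-- Satisfaction in the group `A` of a formula under an assignment of elements `a` to the object
variables and of relations `b` to the predicate variables, where the predicate quantifiers range
over the relations of power at most `κ`. -/
def Sat {A : Type*} [AddCommGroup A] (κ : Cardinal) :
    SOFormula → (ℕ → A) → ((l : ℕ) → ℕ → Set (Fin (l + 1) → A)) → Prop
  | eq i j, a, _ => a i = a j
  | add i j k, a, _ => a i = a j + a k
  | pred l i t, a, b => (fun s => a (t s)) ∈ b l i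
  | neg φ, a, b => ¬ Sat κ φ a b
  | and φ ψ, a, b => Sat κ φ a b ∧ Sat κ ψ a b
  | all i φ, a, b => ∀ m : A, Sat κ φ (Function.update a i m) b
  | allPred l i φ, a, b => ∀ c : Set (Fin (l + 1) → A), #c ≤ κ →
      Sat κ φ a (Function.update b l (Function.update (b l) i c))

end SOFormula

/-- The theory `Th₂^κ(A)`: the second order theory of the group `A` with all relations restricted
to the power at most `κ`. -/
def SecondOrderTheory (κ : Cardinal) (A : Type*) [AddCommGroup A] : Set SOFormula :=
  {φ | φ.IsSentence ∧ ∀ (a : ℕ → A) (b : (l : ℕ) → ℕ → Set (Fin (l + 1) → A)),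
    (∀ l i, #(b l i) ≤ κ) → φ.Sat κ a b}

/-! ### The first order language of rings -/

/-- The relation symbols of the ring language: three-place symbols of multiplication and of
addition. -/
inductive RingRelation : ℕ → Type
  | mul : RingRelation 3
  | add : RingRelation 3

/-- The first order ring language, with relation symbols `x₁ = x₂ x₃` and `x₁ = x₂ + x₃` and
without function or constant symbols. -/
def ringLanguage : FirstOrder.Language.{0, 0} where
  Functions := fun _ => Empty
  Relations := RingRelation

/-- Every ring is a structure for the ring language. -/
instance ringLanguageStructure (R : Type*) [Ring R] : ringLanguage.Structure R where
  funMap := fun f _ => f.elim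
  RelMap := fun r x =>
    match r, x with
    | .mul, x => x 0 = x 1 * x 2
    | .add, x => x 0 = x 1 + x 2

/-!
The endomorphism ring of a reduced group with countable basic subgroups is interpreted in the
second order theory with countable relations, by the same formulas for all such groups.

Let `B` be the sum over all primes of countable basic subgroups. It is countable and `A ⧸ B` is
divisible, so, as `A` is reduced, an endomorphism is determined by its restriction to `B`, which is
a countable relation. It remains to define which homomorphisms `B → A` extend to `A`. Divisibility
by all integers need not be expressed for this. Call a subgroup `C ≥ B` *tight* (`IsTight`) if a
homomorphism `C → A` is determined by its restriction to `B`; for countable `C` this is a condition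
on countable relations only. Call `B` a *countable base* (`IsCountableBase`) if every element lies
in a countable tight subgroup. The sum of basic subgroups is one (`exists_isCountableBase`), since
every element can be made divisible modulo `B` inside a countable subgroup. Sums of tight subgroups
are tight, hence a homomorphism on a countable base that extends to every countable tight subgroup
extends to `A`, the extensions being compatible (`IsCountableBase.exists_extension`).

So endomorphisms are coded by countable relations satisfying a formula (`sat_isEnd`), and their sum
and product are definable; for the product `G * H`, the value of `G` at `H x` is computed by
extending `G` to a tight subgroup containing `H x` (`sat_endMul`). This translates ring sentences
into second order formulas (`sat_translate`). Since "there is a countable base such that …" has a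
truth value independent of the assignment, taking the universal closure (`close`) turns the
translation into a sentence without changing its meaning.
-/

/-! ### Countable subgroups that determine homomorphisms -/

section Algebra

variable {A : Type*} [AddCommGroup A]

/-- A subgroup `C` is tight over `B` if it contains `B` and a homomorphism from `C` to the whole
group is determined by its restriction to `B`. -/
def IsTight (B C : AddSubgroup A) : Prop :=
  B ≤ C ∧ ∀ f : C →+ A, (∀ x : C, (x : A) ∈ B → f x = 0) → f = 0

/-- A subgroup `B` is a countable base if every element of the group lies in a countable subgroup
that is tight over `B`. (It is then countable itself, being contained in such a subgroup.) -/
def IsCountableBase (B : AddSubgroup A) : Prop :=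
  ∀ x : A, ∃ C : AddSubgroup A, (C : Set A).Countable ∧ IsTight B C ∧ x ∈ C

theorem IsCountableBase.countable {B : AddSubgroup A} (hB : IsCountableBase B) :
    (B : Set A).Countable := by
  obtain ⟨C, hC, hBC, -⟩ := hB 0
  exact hC.mono hBC.1

/-- `f` agrees with `g` on `B`; both homomorphisms take values in the whole group. -/
def AgreeOn {B C : AddSubgroup A} (g : B →+ A) (f : C →+ A) : Prop :=
  ∀ x (hB : x ∈ B) (hC : x ∈ C), f ⟨x, hC⟩ = g ⟨x, hB⟩

theorem IsTight.eq_of_agreeOn {B C : AddSubgroup A} (h : IsTight B C) {g : B →+ A}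
    {f f' : C →+ A} (hf : AgreeOn g f) (hf' : AgreeOn g f') : f = f' := by
  refine sub_eq_zero.1 (h.2 (f - f') fun x hx => ?_)
  rw [AddMonoidHom.sub_apply, hf x hx x.2, hf' x hx x.2, sub_self]

theorem IsTight.sup {B C D : AddSubgroup A} (hC : IsTight B C) (hD : IsTight B D) :
    IsTight B (C ⊔ D) := by
  refine ⟨hC.1.trans le_sup_left, fun f hf => ?_⟩
  have h1 := hC.2 (f.comp (AddSubgroup.inclusion le_sup_left)) fun x hx => hf _ hx
  have h2 := hD.2 (f.comp (AddSubgroup.inclusion le_sup_right)) fun x hx => hf _ hx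
  ext ⟨x, hx⟩
  obtain ⟨c, hc, d, hd, rfl⟩ := AddSubgroup.mem_sup.1 hx
  have h3 := DFunLike.congr_fun h1 ⟨c, hc⟩
  have h4 := DFunLike.congr_fun h2 ⟨d, hd⟩
  have h5 := f.map_add (AddSubgroup.inclusion le_sup_left ⟨c, hc⟩)
    (AddSubgroup.inclusion le_sup_right ⟨d, hd⟩)
  simp only [AddMonoidHom.comp_apply, AddMonoidHom.zero_apply] at h3 h4
  rw [h3, h4, add_zero] at h5
  exact h5

theorem AddSubgroup.countable_sup {C D : AddSubgroup A} (hC : (C : Set A).Countable)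
    (hD : (D : Set A).Countable) : ((C ⊔ D : AddSubgroup A) : Set A).Countable := by
  refine (hC.image2 hD (· + ·)).mono fun x hx => ?_
  obtain ⟨c, hc, d, hd, rfl⟩ := AddSubgroup.mem_sup.1 hx
  exact ⟨c, hc, d, hd, rfl⟩

theorem AddSubgroup.countable_closure {s : Set A} (hs : s.Countable) :
    (AddSubgroup.closure s : Set A).Countable := by
  have : Countable s := hs.to_subtype
  have h : (AddSubgroup.closure s : Set A)
      = Set.range (Finsupp.linearCombination ℤ ((↑) : s → A)) := by
    rw [← LinearMap.coe_range, Finsupp.range_linearCombination, Subtype.range_coe,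
      ← Submodule.coe_toAddSubgroup, Submodule.span_int_eq_addSubgroupClosure]
  rw [h]
  exact Set.countable_range _

/-- Extensions of the same homomorphism to two countable tight subgroups agree where both are
defined, because both are restrictions of the extension to the sum. -/
theorem agreeOn_of_extensions {B C D : AddSubgroup A} {g : B →+ A}
    (hg : ∀ C : AddSubgroup A, (C : Set A).Countable → IsTight B C → ∃ f : C →+ A, AgreeOn g f)
    (hC : (C : Set A).Countable) (hBC : IsTight B C) (hD : (D : Set A).Countable)
    (hBD : IsTight B D) {f : C →+ A} {f' : D →+ A} (hf : AgreeOn g f) (hf' : AgreeOn g f') :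
    AgreeOn f f' := by
  obtain ⟨e, he⟩ := hg _ (AddSubgroup.countable_sup hC hD) (hBC.sup hBD)
  have h1 : f = e.comp (AddSubgroup.inclusion le_sup_left) :=
    hBC.eq_of_agreeOn hf fun x hB hC => he x hB _
  have h2 : f' = e.comp (AddSubgroup.inclusion le_sup_right) :=
    hBD.eq_of_agreeOn hf' fun x hB hC => he x hB _
  intro x hx hx'
  rw [h1, h2]
  rfl

/-- A homomorphism defined on a countable base extends to an endomorphism as soon as it extends
to every countable tight subgroup. -/
theorem IsCountableBase.exists_extension {B : AddSubgroup A} (hB : IsCountableBase B)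
    {g : B →+ A}
    (hg : ∀ C : AddSubgroup A, (C : Set A).Countable → IsTight B C → ∃ f : C →+ A, AgreeOn g f) :
    ∃ F : AddMonoid.End A, ∀ x (hx : x ∈ B), F x = g ⟨x, hx⟩ := by
  choose C hC hBC hmem using hB
  choose f hf using fun x => hg (C x) (hC x) (hBC x)
  have key : ∀ (D : AddSubgroup A), (D : Set A).Countable → IsTight B D → ∀ e : D →+ A,
      AgreeOn g e → ∀ x (hx : x ∈ D), f x ⟨x, hmem x⟩ = e ⟨x, hx⟩ := fun D hD hBD e he x hx =>
    agreeOn_of_extensions hg hD hBD (hC x) (hBC x) he (hf x) x hx (hmem x)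
  refine ⟨AddMonoidHom.mk' (fun x => f x ⟨x, hmem x⟩) fun x y => ?_, fun x hx => ?_⟩
  · have hD := AddSubgroup.countable_sup (hC x) (hC y)
    have hBD := (hBC x).sup (hBC y)
    obtain ⟨e, he⟩ := hg _ hD hBD
    have hx : x ∈ C x ⊔ C y := AddSubgroup.mem_sup_left (hmem x)
    have hy : y ∈ C x ⊔ C y := AddSubgroup.mem_sup_right (hmem y)
    rw [key _ hD hBD e he x hx, key _ hD hBD e he y hy, key _ hD hBD e he _ (add_mem hx hy),
      ← map_add]
    rfl
  · exact hf x x hx (hmem x)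

theorem IsCountableBase.end_ext {B : AddSubgroup A} (hB : IsCountableBase B)
    {F G : AddMonoid.End A} (h : ∀ x ∈ B, F x = G x) : F = G := by
  ext x
  obtain ⟨C, -, hBC, hx⟩ := hB x
  have := hBC.eq_of_agreeOn (g := (F : A →+ A).comp B.subtype)
    (f := (F : A →+ A).comp C.subtype) (f' := (G : A →+ A).comp C.subtype)
    (fun _ _ _ => rfl) (fun y hy _ => (h y hy).symm)
  exact DFunLike.congr_fun this ⟨x, hx⟩

/-! ### A countable base from countable basic subgroups -/

theorem exists_sub_nsmul_mem {B : AddSubgroup A}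
    (h : ∀ p : ℕ, p.Prime → ∀ x : A, ∃ y : A, x - p • y ∈ B) {n : ℕ} (hn : n ≠ 0) (x : A) :
    ∃ y : A, x - n • y ∈ B := by
  induction n using Nat.recOnMul generalizing x with
  | zero => exact absurd rfl hn
  | one => exact ⟨x, by simp⟩
  | prime p hp => exact h p hp x
  | mul a b iha ihb =>
    obtain ⟨y, hy⟩ := iha (left_ne_zero_of_mul hn) x
    obtain ⟨z, hz⟩ := ihb (right_ne_zero_of_mul hn) y
    refine ⟨z, ?_⟩
    have : x - (a * b) • z = (x - a • y) + a • (y - b • z) := by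
      rw [smul_sub, mul_smul]; abel
    rw [this]
    exact add_mem hy (nsmul_mem hz a)

/-- A countable subgroup with divisible quotient is a countable base of a reduced group: a chain
of elements `y k ≡ (k + 1) • y (k + 1)` modulo `B` starting at the given element generates
together with `B` a tight subgroup, since homomorphisms vanishing on `B` have divisible image. -/
theorem isCountableBase_of_divisible (hA : IsReducedGroup A) {B : AddSubgroup A}
    (hB : (B : Set A).Countable)
    (hdiv : ∀ p : ℕ, p.Prime → ∀ x : A, ∃ y : A, x - p • y ∈ B) : IsCountableBase B := by
  intro x
  choose d hd using fun (k : ℕ) (x : A) => exists_sub_nsmul_mem hdiv (Nat.succ_ne_zero k) x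
  let y : ℕ → A := fun k => Nat.rec x (fun k z => d k z) k
  have hy : ∀ k, y k - (k + 1) • y (k + 1) ∈ B := fun k => hd k (y k)
  have hyC : ∀ k, y k ∈ AddSubgroup.closure ((B : Set A) ∪ Set.range y) := fun k =>
    AddSubgroup.subset_closure (Or.inr ⟨k, rfl⟩)
  refine ⟨AddSubgroup.closure ((B : Set A) ∪ Set.range y),
    AddSubgroup.countable_closure (hB.union (Set.countable_range y)),
    ⟨fun b hb => AddSubgroup.subset_closure (Or.inl hb), fun f hf => ?_⟩, hyC 0⟩
  have hstep : ∀ k, f ⟨y k, hyC k⟩ = (k + 1) • f ⟨y (k + 1), hyC (k + 1)⟩ := by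
    intro k
    rw [← sub_eq_zero, ← map_nsmul, ← map_sub]
    exact hf _ (hy k)
  rw [← AddMonoidHom.range_eq_bot_iff]
  refine hA _ fun n hn a ha => ?_
  obtain ⟨⟨c, hc⟩, rfl⟩ := ha
  -- Along the chain, divisibility by `n` holds at some later index and descends.
  have hchain : ∀ k, ∃ z ∈ f.range, n • z = f ⟨y k, hyC k⟩ := by
    intro k
    have hlast : ∃ z ∈ f.range, n • z = f ⟨y (n * (k + 1) - 1), hyC _⟩ := by
      have hpos : 0 < n * (k + 1) := Nat.mul_pos hn k.succ_pos
      have h := hstep (n * (k + 1) - 1)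
      rw [Nat.sub_add_cancel hpos, mul_smul] at h
      refine ⟨_, ?_, h.symm⟩
      exact nsmul_mem (AddMonoidHom.mem_range.2 ⟨_, rfl⟩) _
    refine Nat.decreasingInduction'
      (P := fun m => ∃ z ∈ f.range, n • z = f ⟨y m, hyC m⟩) ?_
      (show k ≤ n * (k + 1) - 1 from ?_) hlast
    · rintro m - - ⟨z, hz, hzm⟩
      refine ⟨(m + 1) • z, nsmul_mem hz _, ?_⟩
      rw [hstep m, ← hzm, smul_comm]
    · exact Nat.le_sub_one_of_lt (Nat.le_mul_of_pos_left (k + 1) hn)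
  induction hc using AddSubgroup.closure_induction with
  | mem c hc' =>
    rcases hc' with hcB | ⟨k, rfl⟩
    · exact ⟨0, zero_mem _, by rw [smul_zero]; exact (hf _ hcB).symm⟩
    · exact hchain k
  | zero => exact ⟨0, zero_mem _, by rw [smul_zero]; exact (map_zero f).symm⟩
  | add u v hu hv ihu ihv =>
    obtain ⟨z, hz, hzu⟩ := ihu
    obtain ⟨w, hw, hwv⟩ := ihv
    refine ⟨z + w, add_mem hz hw, ?_⟩
    rw [smul_add, hzu, hwv, ← map_add]
    rfl
  | neg u hu ihu =>
    obtain ⟨z, hz, hzu⟩ := ihu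
    refine ⟨-z, neg_mem hz, ?_⟩
    rw [smul_neg, hzu, ← map_neg]
    rfl

/-- The sum over all primes of countable basic subgroups is countable, and the quotient by it
is divisible. -/
theorem exists_isCountableBase (hA : IsReducedGroup A) (hb : HasCountableBasicSubgroups A) :
    ∃ B : AddSubgroup A, IsCountableBase B := by
  choose B hB hBc using hb
  refine ⟨AddSubgroup.closure (⋃ p : Nat.Primes, (B p p.2 : Set A)),
    isCountableBase_of_divisible hA (AddSubgroup.countable_closure
      (Set.countable_iUnion fun p => hBc p p.2)) fun p hp x => ?_⟩
  obtain ⟨y, hy⟩ := (hB p hp).divisible (QuotientAddGroup.mk x)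
  obtain ⟨y, rfl⟩ := QuotientAddGroup.mk_surjective y
  refine ⟨y, AddSubgroup.subset_closure (Set.mem_iUnion.2 ⟨⟨p, hp⟩, ?_⟩)⟩
  rw [← QuotientAddGroup.mk_nsmul, QuotientAddGroup.eq, neg_add_eq_sub] at hy
  exact hy

end Algebra

/-! ### Quantification over countable sets and binary relations -/

/-- Assignments of relations to the predicate variables. -/
abbrev PredAssignment (A : Type*) := (l : ℕ) → ℕ → Set (Fin (l + 1) → A)

namespace PredAssignment

variable {A : Type*}

/-- The set assigned to the `i`-th one-place predicate variable. -/
def un (b : PredAssignment A) (i : ℕ) : Set A := {x | (fun _ => x) ∈ b 0 i}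

/-- The relation assigned to the `i`-th two-place predicate variable. -/
def bin (b : PredAssignment A) (i : ℕ) : Set (A × A) := {p | ![p.1, p.2] ∈ b 1 i}

/-- The assignment of the relation `c` to the predicate variable `(l, i)`. -/
def assign (b : PredAssignment A) (l i : ℕ) (c : Set (Fin (l + 1) → A)) : PredAssignment A :=
  Function.update b l (Function.update (b l) i c)

/-- The assignment of the set `C` to the `i`-th one-place predicate variable. -/
def assignUn (b : PredAssignment A) (i : ℕ) (C : Set A) : PredAssignment A :=
  b.assign 0 i {v | v 0 ∈ C}

/-- The assignment of the relation `R` to the `i`-th two-place predicate variable. -/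
def assignBin (b : PredAssignment A) (i : ℕ) (R : Set (A × A)) : PredAssignment A :=
  b.assign 1 i {v | (v 0, v 1) ∈ R}

@[simp]
theorem un_assignUn (b : PredAssignment A) (i j : ℕ) (C : Set A) :
    (b.assignUn i C).un j = if j = i then C else b.un j := by
  ext x
  by_cases h : j = i
  · subst h; simp [un, assignUn, assign]
  · simp [un, assignUn, assign, h]

@[simp]
theorem bin_assignUn (b : PredAssignment A) (i j : ℕ) (C : Set A) :
    (b.assignUn i C).bin j = b.bin j := by
  ext x
  simp [bin, assignUn, assign]

@[simp]
theorem un_assignBin (b : PredAssignment A) (i j : ℕ) (R : Set (A × A)) :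
    (b.assignBin i R).un j = b.un j := by
  ext x
  simp [un, assignBin, assign]

@[simp]
theorem bin_assignBin (b : PredAssignment A) (i j : ℕ) (R : Set (A × A)) :
    (b.assignBin i R).bin j = if j = i then R else b.bin j := by
  ext x
  by_cases h : j = i
  · subst h; simp [bin, assignBin, assign]
  · simp [bin, assignBin, assign, h]

end PredAssignment

namespace SOFormula

/-- Implication. -/
def imp (φ ψ : SOFormula) : SOFormula := neg (and φ (neg ψ))

/-- `∃ x_i φ` -/
def ex (i : ℕ) (φ : SOFormula) : SOFormula := neg (all i (neg φ))

/-- `∃ P φ`, where `P` is the predicate variable `(l, i)` -/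
def exPred (l i : ℕ) (φ : SOFormula) : SOFormula := neg (allPred l i (neg φ))

/-- `x_j ∈ P`, where `P` is the predicate variable `(0, i)` -/
def mem (i j : ℕ) : SOFormula := pred 0 i fun _ => j

/-- `P(x_j, x_k)`, where `P` is the predicate variable `(1, i)` -/
def rel (i j k : ℕ) : SOFormula := pred 1 i ![j, k]

section Sat

variable {A : Type*} [AddCommGroup A] {κ : Cardinal} (a : ℕ → A) (b : PredAssignment A)

theorem sat_eq (i j : ℕ) : Sat κ (eq i j) a b ↔ a i = a j := Iff.rfl

theorem sat_add (i j k : ℕ) : Sat κ (add i j k) a b ↔ a i = a j + a k := Iff.rfl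

theorem sat_neg (φ : SOFormula) : Sat κ (neg φ) a b ↔ ¬ Sat κ φ a b := Iff.rfl

theorem sat_and (φ ψ : SOFormula) : Sat κ (and φ ψ) a b ↔ Sat κ φ a b ∧ Sat κ ψ a b := Iff.rfl

theorem sat_all (i : ℕ) (φ : SOFormula) :
    Sat κ (all i φ) a b ↔ ∀ m : A, Sat κ φ (Function.update a i m) b := Iff.rfl

theorem sat_imp (φ ψ : SOFormula) : Sat κ (imp φ ψ) a b ↔ (Sat κ φ a b → Sat κ ψ a b) := by
  simp [imp, sat_neg, sat_and]

theorem sat_ex (i : ℕ) (φ : SOFormula) :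
    Sat κ (ex i φ) a b ↔ ∃ m : A, Sat κ φ (Function.update a i m) b := by
  simp [ex, sat_neg, sat_all]

theorem sat_mem (i j : ℕ) : Sat κ (mem i j) a b ↔ a j ∈ b.un i := Iff.rfl

theorem sat_rel (i j k : ℕ) : Sat κ (rel i j k) a b ↔ (a j, a k) ∈ b.bin i := by
  have : (fun s => a ((![j, k] : Fin 2 → ℕ) s)) = ![a j, a k] := by
    funext s
    fin_cases s <;> rfl
  change (fun s => a ((![j, k] : Fin 2 → ℕ) s)) ∈ b 1 i ↔ _
  rw [this]
  rfl

theorem sat_allPred (l i : ℕ) (φ : SOFormula) :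
    Sat ℵ₀ (allPred l i φ) a b ↔
      ∀ c : Set (Fin (l + 1) → A), c.Countable → Sat ℵ₀ φ a (b.assign l i c) := by
  simp only [← Cardinal.le_aleph0_iff_set_countable]
  rfl

theorem sat_allUn (i : ℕ) (φ : SOFormula) :
    Sat ℵ₀ (allPred 0 i φ) a b ↔
      ∀ C : Set A, C.Countable → Sat ℵ₀ φ a (b.assignUn i C) := by
  rw [sat_allPred]
  constructor
  · intro h C hC
    refine h _ ((hC.preimage (f := fun v : Fin 1 → A => v 0) fun v w hvw => ?_))
    funext s
    rw [Subsingleton.elim s 0]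
    exact hvw
  · intro h c hc
    have h1 := h ((fun x (_ : Fin 1) => x) ⁻¹' c)
      (hc.preimage fun x y hxy => congrFun hxy 0)
    have h2 : {v : Fin 1 → A | v 0 ∈ (fun x (_ : Fin 1) => x) ⁻¹' c} = c := by
      ext v
      have : (fun _ => v 0) = v := funext fun s => by rw [Subsingleton.elim s 0]
      simp [this]
    rw [PredAssignment.assignUn, h2] at h1
    exact h1

theorem sat_allBin (i : ℕ) (φ : SOFormula) :
    Sat ℵ₀ (allPred 1 i φ) a b ↔
      ∀ R : Set (A × A), R.Countable → Sat ℵ₀ φ a (b.assignBin i R) := by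
  rw [sat_allPred]
  constructor
  · intro h R hR
    refine h _ ((hR.preimage (f := fun v : Fin 2 → A => (v 0, v 1)) fun v w hvw => ?_))
    have hvw' := Prod.ext_iff.1 hvw
    funext s
    fin_cases s
    · exact hvw'.1
    · exact hvw'.2
  · intro h c hc
    have h1 := h ((fun p : A × A => ![p.1, p.2]) ⁻¹' c)
      (hc.preimage fun x y hxy => Prod.ext (congrFun hxy 0) (congrFun hxy 1))
    have h2 : {v : Fin 2 → A | (v 0, v 1) ∈ (fun p : A × A => ![p.1, p.2]) ⁻¹' c} = c := by
      ext v
      have : ![v 0, v 1] = v := by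
        funext s
        fin_cases s <;> rfl
      simp [this]
    rw [PredAssignment.assignBin, h2] at h1
    exact h1

theorem sat_exUn (i : ℕ) (φ : SOFormula) :
    Sat ℵ₀ (exPred 0 i φ) a b ↔
      ∃ C : Set A, C.Countable ∧ Sat ℵ₀ φ a (b.assignUn i C) := by
  simp [exPred, sat_neg, sat_allUn]

theorem sat_exBin (i : ℕ) (φ : SOFormula) :
    Sat ℵ₀ (exPred 1 i φ) a b ↔
      ∃ R : Set (A × A), R.Countable ∧ Sat ℵ₀ φ a (b.assignBin i R) := by
  simp [exPred, sat_neg, sat_allBin]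

end Sat

/-! ### Formulas for subgroups, homomorphisms and tightness -/

/-- The `i`-th one-place predicate is a subgroup. -/
def isSubgroup (i : ℕ) : SOFormula :=
  and (ex 0 (mem i 0))
    (all 0 (all 1 (all 2 (imp (mem i 0) (imp (mem i 1) (imp (add 0 1 2) (mem i 2)))))))

/-- The `j`-th two-place predicate is the graph of a homomorphism defined on the `i`-th one-place
predicate, provided that the latter is a subgroup. -/
def isHom (i j : ℕ) : SOFormula :=
  and (all 0 (all 1 (imp (rel j 0 1) (mem i 0))))
    (and (all 0 (imp (mem i 0) (ex 1 (rel j 0 1))))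
      (and (all 0 (all 1 (all 2 (imp (rel j 0 1) (imp (rel j 0 2) (eq 1 2))))))
        (all 0 (all 1 (all 2 (all 3 (all 4 (all 5
          (imp (rel j 0 1) (imp (rel j 2 3)
            (imp (add 4 0 2) (imp (add 5 1 3) (rel j 4 5)))))))))))))

/-- The set variable `1` is a subgroup that is tight over the set variable `0`. The relation
variable `0` is used as a bound variable. -/
def isTight : SOFormula :=
  and (isSubgroup 1) (and (all 0 (imp (mem 0 0) (mem 1 0)))
    (allPred 1 0 (imp (isHom 1 0)
      (imp (all 0 (all 1 (imp (mem 0 0) (imp (rel 0 0 1) (add 1 1 1)))))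
        (all 0 (all 1 (imp (rel 0 0 1) (add 1 1 1))))))))

/-- The set variable `0` is a subgroup that is a countable base. -/
def isBase : SOFormula :=
  and (isSubgroup 0) (all 6 (exPred 0 1 (and isTight (mem 1 6))))

/-- The `j`-th two-place predicate is contained in the relation variable `0`. -/
def isRestriction (j : ℕ) : SOFormula :=
  all 0 (all 1 (imp (rel j 0 1) (rel 0 0 1)))

/-- The `j`-th two-place predicate is the graph of the restriction of an endomorphism to the set
variable `0`, provided that the latter is a countable base. The trivial conjunct gives the
existence of an extension the same shape as in `endMul`. -/
def isEnd (j : ℕ) : SOFormula :=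
  and (isHom 0 j)
    (allPred 0 1 (imp isTight
      (exPred 1 0 (and (isHom 1 0) (and (isRestriction j) (all 0 (eq 0 0)))))))

/-- The sum of endomorphisms: `i = j + k`. -/
def endAdd (i j k : ℕ) : SOFormula :=
  all 0 (all 1 (all 2 (all 3
    (imp (rel i 0 1) (imp (rel j 0 2) (imp (rel k 0 3) (add 1 2 3)))))))

/-- The product of endomorphisms: `i = j * k`. The value of `j` outside of the countable base is
computed by extending `j` to a tight subgroup. -/
def endMul (i j k : ℕ) : SOFormula :=
  all 7 (all 8 (all 9 (imp (rel i 7 8) (imp (rel k 7 9)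
    (exPred 0 1 (and isTight (and (mem 1 9)
      (exPred 1 0 (and (isHom 1 0) (and (isRestriction j) (rel 0 9 8)))))))))))

/-- Equality of endomorphisms. -/
def endEq (i j : ℕ) : SOFormula :=
  all 0 (all 1 (imp (rel i 0 1) (rel j 0 1)))

section Meaning

variable {A : Type*} [AddCommGroup A] {a : ℕ → A} {b : PredAssignment A}

/-- The graph of a homomorphism from a subgroup to the whole group. -/
def homGraph {B : AddSubgroup A} (f : B →+ A) : Set (A × A) :=
  Set.range fun x : B => ((x : A), f x)

theorem mem_homGraph {B : AddSubgroup A} {f : B →+ A} {p : A × A} :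
    p ∈ homGraph f ↔ ∃ h : p.1 ∈ B, f ⟨p.1, h⟩ = p.2 := by
  constructor
  · rintro ⟨x, rfl⟩
    exact ⟨x.2, rfl⟩
  · rintro ⟨h, h'⟩
    exact ⟨⟨p.1, h⟩, Prod.ext rfl h'⟩

theorem countable_homGraph {B : AddSubgroup A} (hB : (B : Set A).Countable) (f : B →+ A) :
    (homGraph f).Countable := by
  have : Countable B := hB.to_subtype
  exact Set.countable_range _

theorem homGraph_subset {B C : AddSubgroup A} (h : B ≤ C) {g : B →+ A} {f : C →+ A} :
    homGraph g ⊆ homGraph f ↔ AgreeOn g f := by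
  constructor
  · intro hs x hB hC
    obtain ⟨_, h'⟩ := mem_homGraph.1 (hs ⟨⟨x, hB⟩, rfl⟩)
    exact h'
  · rintro hs _ ⟨x, rfl⟩
    exact mem_homGraph.2 ⟨h x.2, hs x x.2 (h x.2)⟩

theorem sat_isSubgroup (i : ℕ) :
    Sat ℵ₀ (isSubgroup i) a b ↔ ∃ B : AddSubgroup A, b.un i = B := by
  simp only [isSubgroup, sat_and, sat_ex, sat_all, sat_imp, sat_mem, sat_add, Function.update_self,
    Function.update_apply, reduceIte, OfNat.zero_ne_ofNat, zero_ne_one, OfNat.one_ne_ofNat]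
  constructor
  · rintro ⟨⟨x, hx⟩, h⟩
    have h0 : 0 ∈ b.un i := h x x 0 hx hx (add_zero x).symm
    have hn : ∀ y ∈ b.un i, -y ∈ b.un i := fun y hy => h 0 y (-y) h0 hy (add_neg_cancel y).symm
    exact ⟨{  carrier := b.un i
              zero_mem' := h0
              neg_mem' := fun {y} hy => hn y hy
              add_mem' := fun {y z} hy hz => h y (-z) (y + z) hy (hn z hz) (by abel) }, rfl⟩
  · rintro ⟨B, hB⟩
    rw [hB]
    refine ⟨⟨0, zero_mem B⟩, fun x y z hx hy hxyz => ?_⟩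
    have : z = x - y := by rw [hxyz]; abel
    rw [this]
    exact sub_mem hx hy

theorem sat_isHom {i j : ℕ} {B : AddSubgroup A} (hB : b.un i = B) :
    Sat ℵ₀ (isHom i j) a b ↔ ∃ f : B →+ A, b.bin j = homGraph f := by
  simp only [isHom, sat_and, sat_ex, sat_all, sat_imp, sat_mem, sat_rel, sat_add, sat_eq, hB,
    SetLike.mem_coe, Function.update_apply, reduceIte, OfNat.ofNat_ne_zero, OfNat.zero_ne_ofNat,
    one_ne_zero, zero_ne_one, OfNat.ofNat_ne_one, OfNat.one_ne_ofNat, Nat.reduceEqDiff]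
  constructor
  · rintro ⟨hdom, hex, huniq, hadd⟩
    choose f hf using hex
    refine ⟨AddMonoidHom.mk' (fun x : B => f x x.2) fun x y =>
      huniq _ _ _ (hf _ (x + y).2) (hadd _ _ _ _ _ _ (hf x x.2) (hf y y.2) rfl rfl), ?_⟩
    ext ⟨x, y⟩
    rw [mem_homGraph]
    refine ⟨fun h => ⟨hdom x y h, huniq x _ _ (hf x _) h⟩, ?_⟩
    rintro ⟨hx, hxy⟩
    simp only at hx hxy
    rw [← hxy]
    exact hf x hx
  · rintro ⟨f, hf⟩
    simp only [hf, mem_homGraph]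
    refine ⟨fun x y h => h.1, fun x hx => ⟨f ⟨x, hx⟩, hx, rfl⟩, ?_, ?_⟩
    · rintro x y z ⟨_, hy⟩ ⟨_, hz⟩
      rw [← hy, ← hz]
    · rintro x y z w u v ⟨hx, hy⟩ ⟨hz, hw⟩ rfl rfl
      rw [← hy, ← hw]
      exact ⟨add_mem hx hz, map_add f ⟨x, hx⟩ ⟨z, hz⟩⟩

theorem sat_isTight {B : AddSubgroup A} (hB : b.un 0 = B) (hc : (b.un 1).Countable) :
    Sat ℵ₀ isTight a b ↔ ∃ C : AddSubgroup A, b.un 1 = C ∧ IsTight B C := by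
  rw [isTight, sat_and, sat_isSubgroup, sat_and, ← exists_and_right]
  refine exists_congr fun C => and_congr_right fun hC => ?_
  have hCc : (C : Set A).Countable := hC ▸ hc
  have hhom : ∀ R : Set (A × A), Sat ℵ₀ (isHom 1 0) a (b.assignBin 0 R) ↔
      ∃ f : C →+ A, R = homGraph f := fun R => by
    rw [sat_isHom (B := C) (by simpa using hC)]
    simp
  simp only [sat_allBin, sat_imp, hhom]
  simp only [sat_all, sat_imp, sat_mem, sat_rel, sat_add, hB, hC, Function.update_apply, reduceIte,
    zero_ne_one, SetLike.mem_coe, PredAssignment.un_assignBin, PredAssignment.bin_assignBin,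
    left_eq_add]
  refine and_congr Iff.rfl ⟨fun h f hf => ?_, ?_⟩
  · have h' := h _ (countable_homGraph hCc f) ⟨f, rfl⟩ (fun x y hx hxy => ?_)
    · ext x
      exact h' x (f x) ⟨x, rfl⟩
    · obtain ⟨_, h1⟩ := mem_homGraph.1 hxy
      exact h1.symm.trans (hf _ hx)
  · rintro h _ - ⟨f, rfl⟩ hR x y hxy
    obtain ⟨h1, h2⟩ := mem_homGraph.1 hxy
    exact h2.symm.trans (DFunLike.congr_fun (h f fun z hz => hR z (f z) hz ⟨z, rfl⟩) _)

theorem sat_isBase :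
    Sat ℵ₀ isBase a b ↔ ∃ B : AddSubgroup A, b.un 0 = B ∧ IsCountableBase B := by
  rw [isBase, sat_and, sat_isSubgroup, ← exists_and_right]
  refine exists_congr fun B => and_congr_right fun hB => ?_
  simp only [sat_all, sat_exUn, sat_and, sat_mem]
  refine forall_congr' fun x => ⟨?_, ?_⟩
  · rintro ⟨C, hC, h1, h2⟩
    rw [sat_isTight (B := B) (by simpa using hB) (by simpa using hC)] at h1
    obtain ⟨C, rfl, hBC⟩ := by simpa using h1
    exact ⟨C, hC, hBC, by simpa using h2⟩
  · rintro ⟨C, hC, hBC, hx⟩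
    refine ⟨C, hC, ?_, by simpa using hx⟩
    rw [sat_isTight (B := B) (by simpa using hB) (by simpa using hC)]
    exact ⟨C, by simp, hBC⟩

/-- The restriction of an endomorphism to a subgroup. -/
def restrictEnd (B : AddSubgroup A) (F : AddMonoid.End A) : B →+ A :=
  (F : A →+ A).comp B.subtype

theorem mem_homGraph_restrictEnd {B : AddSubgroup A} {F : AddMonoid.End A} {x y : A} :
    (x, y) ∈ homGraph (restrictEnd B F) ↔ x ∈ B ∧ F x = y := by
  rw [mem_homGraph]
  exact ⟨fun ⟨h, h'⟩ => ⟨h, h'⟩, fun ⟨h, h'⟩ => ⟨h, h'⟩⟩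

/-- Over a tight subgroup `C`, the formula `isRestriction` singles out the homomorphisms that
extend the given one. -/
theorem sat_exists_extension {B C : AddSubgroup A} (hBC : IsTight B C)
    (hC : (C : Set A).Countable) (hbC : b.un 1 = C) {j : ℕ} (hj : j ≠ 0) {g : B →+ A}
    (hg : b.bin j = homGraph g) (φ : SOFormula) :
    Sat ℵ₀ (exPred 1 0 (and (isHom 1 0) (and (isRestriction j) φ))) a b ↔
      ∃ f : C →+ A, AgreeOn g f ∧ Sat ℵ₀ φ a (b.assignBin 0 (homGraph f)) := by
  have hhom : ∀ R : Set (A × A), Sat ℵ₀ (isHom 1 0) a (b.assignBin 0 R) ↔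
      ∃ f : C →+ A, R = homGraph f := fun R => by
    rw [sat_isHom (B := C) (by simpa using hbC)]
    simp
  have hres : ∀ f : C →+ A, Sat ℵ₀ (isRestriction j) a (b.assignBin 0 (homGraph f)) ↔
      AgreeOn g f := fun f => by
    rw [← homGraph_subset hBC.1]
    simp only [isRestriction, sat_all, sat_imp, sat_rel, PredAssignment.bin_assignBin, hj, hg,
      Function.update_apply, reduceIte, zero_ne_one]
    exact ⟨fun h p hp => h p.1 p.2 hp, fun h x y hxy => h hxy⟩
  simp only [sat_exBin, sat_and, hhom]
  constructor
  · rintro ⟨_, -, ⟨f, rfl⟩, h1, h2⟩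
    exact ⟨f, (hres f).1 h1, h2⟩
  · rintro ⟨f, h1, h2⟩
    exact ⟨_, countable_homGraph hC f, ⟨f, rfl⟩, (hres f).2 h1, h2⟩

theorem sat_isEnd {B : AddSubgroup A} (hB : IsCountableBase B) (hbB : b.un 0 = B) {j : ℕ}
    (hj : j ≠ 0) :
    Sat ℵ₀ (isEnd j) a b ↔ ∃ F : AddMonoid.End A, b.bin j = homGraph (restrictEnd B F) := by
  rw [isEnd, sat_and, sat_isHom hbB, sat_allUn]
  simp only [sat_imp]
  constructor
  · rintro ⟨⟨g, hg⟩, h⟩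
    obtain ⟨F, hF⟩ := hB.exists_extension (g := g) fun C hC hBC => by
      have h1 := h C hC ((sat_isTight (B := B) (by simpa using hbB) (by simpa using hC)).2
        ⟨C, by simp, hBC⟩)
      obtain ⟨f, hf, -⟩ := (sat_exists_extension hBC hC (by simp) hj
        (by simpa using hg) _).1 h1
      exact ⟨f, hf⟩
    refine ⟨F, ?_⟩
    rw [hg]
    congr 1
    ext x
    exact (hF x x.2).symm
  · rintro ⟨F, hF⟩
    refine ⟨⟨_, hF⟩, fun C hC hT => ?_⟩
    rw [sat_isTight (B := B) (by simpa using hbB) (by simpa using hC)] at hT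
    obtain ⟨C, rfl, hBC⟩ := by simpa using hT
    exact (sat_exists_extension hBC hC (by simp) hj (by simpa using hF) _).2
      ⟨restrictEnd C F, fun _ _ _ => rfl, fun _ => rfl⟩

theorem sat_endEq {B : AddSubgroup A} (hB : IsCountableBase B) {i j : ℕ} {F G : AddMonoid.End A}
    (hF : b.bin i = homGraph (restrictEnd B F)) (hG : b.bin j = homGraph (restrictEnd B G)) :
    Sat ℵ₀ (endEq i j) a b ↔ F = G := by
  simp only [endEq, sat_all, sat_imp, sat_rel, hF, hG, mem_homGraph_restrictEnd,
    Function.update_apply, reduceIte, zero_ne_one]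
  constructor
  · intro h
    exact hB.end_ext fun x hx => (h x _ ⟨hx, rfl⟩).2.symm
  · rintro rfl x y h
    exact h

theorem sat_endAdd {B : AddSubgroup A} (hB : IsCountableBase B) {i j k : ℕ}
    {F G H : AddMonoid.End A} (hF : b.bin i = homGraph (restrictEnd B F))
    (hG : b.bin j = homGraph (restrictEnd B G)) (hH : b.bin k = homGraph (restrictEnd B H)) :
    Sat ℵ₀ (endAdd i j k) a b ↔ F = G + H := by
  simp only [endAdd, sat_all, sat_imp, sat_rel, sat_add, hF, hG, hH, mem_homGraph_restrictEnd,
    Function.update_apply, reduceIte, zero_ne_one, OfNat.zero_ne_ofNat, OfNat.one_ne_ofNat,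
    Nat.reduceEqDiff]
  constructor
  · intro h
    exact hB.end_ext fun x hx => h x _ _ _ ⟨hx, rfl⟩ ⟨hx, rfl⟩ ⟨hx, rfl⟩
  · rintro rfl x _ _ _ ⟨-, rfl⟩ ⟨-, rfl⟩ ⟨-, rfl⟩
    rfl

theorem sat_endMul {B : AddSubgroup A} (hB : IsCountableBase B) (hbB : b.un 0 = B) {i j k : ℕ}
    (hj : j ≠ 0) {F G H : AddMonoid.End A} (hF : b.bin i = homGraph (restrictEnd B F))
    (hG : b.bin j = homGraph (restrictEnd B G)) (hH : b.bin k = homGraph (restrictEnd B H)) :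
    Sat ℵ₀ (endMul i j k) a b ↔ F = G * H := by
  have hinner : ∀ a : ℕ → A, Sat ℵ₀ (exPred 0 1 (and isTight (and (mem 1 9)
      (exPred 1 0 (and (isHom 1 0) (and (isRestriction j) (rel 0 9 8))))))) a b ↔
      G (a 9) = a 8 := by
    intro a
    simp only [sat_exUn, sat_and]
    constructor
    · rintro ⟨C, hC, hT, hmem, hex⟩
      rw [sat_isTight (B := B) (by simpa using hbB) (by simpa using hC)] at hT
      obtain ⟨C, rfl, hBC⟩ := by simpa using hT
      obtain ⟨f, hf, h⟩ := (sat_exists_extension hBC hC (by simp) hj (by simpa using hG) _).1 hex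
      have hfG : f = restrictEnd C G := hBC.eq_of_agreeOn hf fun _ _ _ => rfl
      rw [sat_rel, PredAssignment.bin_assignBin, if_pos rfl, hfG, mem_homGraph_restrictEnd] at h
      exact h.2
    · intro h
      obtain ⟨C, hC, hBC, hx⟩ := hB (a 9)
      refine ⟨C, hC, ?_, by simpa [sat_mem] using hx, ?_⟩
      · rw [sat_isTight (B := B) (by simpa using hbB) (by simpa using hC)]
        exact ⟨C, by simp, hBC⟩
      · refine (sat_exists_extension hBC hC (by simp) hj (by simpa using hG) _).2
          ⟨restrictEnd C G, fun _ _ _ => rfl, ?_⟩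
        rw [sat_rel, PredAssignment.bin_assignBin, if_pos rfl, mem_homGraph_restrictEnd]
        exact ⟨hx, h⟩
  simp only [endMul, sat_all, sat_imp, hinner]
  simp only [sat_rel, hF, hH, mem_homGraph_restrictEnd, Function.update_apply, reduceIte,
    Nat.reduceEqDiff]
  constructor
  · intro h
    exact hB.end_ext fun x hx => (h x _ _ ⟨hx, rfl⟩ ⟨hx, rfl⟩).symm
  · rintro rfl x _ _ ⟨-, rfl⟩ ⟨-, rfl⟩
    rfl

end Meaning

end SOFormula

/-! ### Translation of ring formulas -/

open FirstOrder FirstOrder.Language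

/-- The index of the variable that a term of the ring language without free variables is. -/
def termIndex {n : ℕ} : ringLanguage.Term (Empty ⊕ Fin n) → ℕ
  | .var (Sum.inr i) => i
  | .var (Sum.inl e) => e.elim
  | .func f _ => f.elim

namespace SOFormula

/-- A formula satisfied by nothing. -/
def bot : SOFormula := neg (all 0 (eq 0 0))

/-- The translation of ring formulas: the ring variable `k` becomes the two-place predicate
variable `k + 1`, which is to be the graph of the restriction of an endomorphism to the countable
base given by the set variable `0`. -/
def translate : {n : ℕ} → ringLanguage.BoundedFormula Empty n → SOFormula
  | _, .falsum => bot
  | _, .equal s t => endEq (termIndex s + 1) (termIndex t + 1)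
  | _, .rel RingRelation.mul t =>
      endMul (termIndex (t 0) + 1) (termIndex (t 1) + 1) (termIndex (t 2) + 1)
  | _, .rel RingRelation.add t =>
      endAdd (termIndex (t 0) + 1) (termIndex (t 1) + 1) (termIndex (t 2) + 1)
  | _, .imp φ ψ => imp (translate φ) (translate ψ)
  | n, .all φ => allPred 1 (n + 1) (imp (isEnd (n + 1)) (translate φ))

variable {A : Type*} [AddCommGroup A]

theorem bin_termIndex {b : PredAssignment A} {B : AddSubgroup A} {n : ℕ}
    {v : Fin n → AddMonoid.End A}
    (hv : ∀ k : Fin n, b.bin (k + 1) = homGraph (restrictEnd B (v k))) {e : Empty → AddMonoid.End A}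
    (t : ringLanguage.Term (Empty ⊕ Fin n)) :
    b.bin (termIndex t + 1) = homGraph (restrictEnd B (t.realize (Sum.elim e v))) := by
  match t with
  | .var (Sum.inr i) => exact hv i
  | .var (Sum.inl e) => exact e.elim
  | .func f _ => exact f.elim

theorem sat_translate {B : AddSubgroup A} (hB : IsCountableBase B) {n : ℕ}
    (φ : ringLanguage.BoundedFormula Empty n) {a : ℕ → A} {b : PredAssignment A}
    (hbB : b.un 0 = B) {e : Empty → AddMonoid.End A} {v : Fin n → AddMonoid.End A}
    (hv : ∀ k : Fin n, b.bin (k + 1) = homGraph (restrictEnd B (v k))) :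
    Sat ℵ₀ (translate φ) a b ↔ φ.Realize e v := by
  induction φ generalizing b with
  | falsum => simp [translate, bot, sat_neg, sat_all, sat_eq, BoundedFormula.Realize]
  | equal s t => exact sat_endEq hB (bin_termIndex hv s) (bin_termIndex hv t)
  | rel R t =>
    cases R with
    | mul =>
      exact sat_endMul hB hbB (Nat.succ_ne_zero _) (bin_termIndex hv (t 0))
        (bin_termIndex hv (t 1)) (bin_termIndex hv (t 2))
    | add =>
      exact sat_endAdd hB (bin_termIndex hv (t 0)) (bin_termIndex hv (t 1))
        (bin_termIndex hv (t 2))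
  | imp φ ψ ihφ ihψ =>
    rw [translate, sat_imp, ihφ hbB hv, ihψ hbB hv, BoundedFormula.realize_imp]
  | @all n φ ih =>
    rw [translate, sat_allBin, BoundedFormula.realize_all]
    have hsnoc : ∀ F : AddMonoid.End A, ∀ k : Fin (n + 1),
        (b.assignBin (n + 1) (homGraph (restrictEnd B F))).bin (k + 1) =
          homGraph (restrictEnd B (Fin.snoc (α := fun _ => AddMonoid.End A) v F k)) := by
      intro F k
      refine Fin.lastCases ?_ (fun k => ?_) k
      · simp
      · simp [hv k, k.2.ne]
    have hend : ∀ R : Set (A × A), Sat ℵ₀ (isEnd (n + 1)) a (b.assignBin (n + 1) R) ↔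
        ∃ F : AddMonoid.End A, R = homGraph (restrictEnd B F) := fun R => by
      rw [sat_isEnd hB (by simpa using hbB) (Nat.succ_ne_zero n)]
      simp
    simp only [sat_imp, hend]
    constructor
    · intro h F
      exact (ih (by simpa using hbB) (hsnoc F)).1
        (h _ (countable_homGraph hB.countable _) ⟨F, rfl⟩)
    · rintro h _ - ⟨F, rfl⟩
      exact (ih (by simpa using hbB) (hsnoc F)).2 (h F)

/-- The second order formula stating that a ring sentence holds in the endomorphism ring, computed
with some countable base. -/
def endSentence (φ : ringLanguage.Sentence) : SOFormula :=
  exPred 0 0 (and isBase (translate φ))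

theorem sat_endSentence (hA : ∃ B : AddSubgroup A, IsCountableBase B)
    (φ : ringLanguage.Sentence) (a : ℕ → A) (b : PredAssignment A) :
    Sat ℵ₀ (endSentence φ) a b ↔ AddMonoid.End A ⊨ φ := by
  have htr : ∀ B : AddSubgroup A, IsCountableBase B →
      (Sat ℵ₀ (translate φ) a (b.assignUn 0 B) ↔ AddMonoid.End A ⊨ φ) := fun B hB =>
    sat_translate hB φ (by simp) fun k => k.elim0
  simp only [endSentence, sat_exUn, sat_and, sat_isBase]
  constructor
  · rintro ⟨_, -, ⟨B, h, hB⟩, hφ⟩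
    obtain rfl := by simpa using h
    exact (htr B hB).1 hφ
  · intro h
    obtain ⟨B, hB⟩ := hA
    exact ⟨B, hB.countable, ⟨B, by simp, hB⟩, (htr B hB).2 h⟩

/-! ### Closing a formula to a sentence -/

/-- The universal closure. -/
noncomputable def close (φ : SOFormula) : SOFormula :=
  φ.freePred.toList.foldr (fun q ψ => allPred q.1 q.2 ψ) (φ.freeVar.toList.foldr all φ)

theorem freeVar_foldr_all (φ : SOFormula) (L : List ℕ) :
    (L.foldr all φ).freeVar = φ.freeVar \ L.toFinset ∧
      (L.foldr all φ).freePred = φ.freePred := by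
  induction L with
  | nil => simp
  | cons i L ih =>
    refine ⟨?_, ih.2⟩
    rw [List.foldr_cons, freeVar, ih.1, List.toFinset_cons, Finset.sdiff_insert]

theorem freeVar_foldr_allPred (φ : SOFormula) (L : List (ℕ × ℕ)) :
    (L.foldr (fun q ψ => allPred q.1 q.2 ψ) φ).freeVar = φ.freeVar ∧
      (L.foldr (fun q ψ => allPred q.1 q.2 ψ) φ).freePred = φ.freePred \ L.toFinset := by
  induction L with
  | nil => simp
  | cons q L ih =>
    refine ⟨ih.1, ?_⟩
    rw [List.foldr_cons, freePred, ih.2, List.toFinset_cons, Finset.sdiff_insert]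

theorem isSentence_close (φ : SOFormula) : φ.close.IsSentence := by
  constructor
  · rw [close, (freeVar_foldr_allPred _ _).1, (freeVar_foldr_all _ _).1]
    simp
  · rw [close, (freeVar_foldr_allPred _ _).2, (freeVar_foldr_all _ _).2]
    simp

/-- If the truth value of a formula does not depend on the assignment, closing does not
change it. -/
theorem sat_close {φ : SOFormula} {Q : Prop} (h : ∀ (a : ℕ → A) b, Sat ℵ₀ φ a b ↔ Q)
    (a : ℕ → A) (b : PredAssignment A) : Sat ℵ₀ φ.close a b ↔ Q := by
  have hvar : ∀ L : List ℕ, ∀ (a : ℕ → A) b, Sat ℵ₀ (L.foldr all φ) a b ↔ Q := by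
    intro L
    induction L with
    | nil => exact h
    | cons i L ih =>
      intro a b
      rw [List.foldr_cons, sat_all]
      simp only [ih, forall_const]
  have hpred : ∀ L : List (ℕ × ℕ), ∀ (a : ℕ → A) b,
      Sat ℵ₀ (L.foldr (fun q ψ => allPred q.1 q.2 ψ) (φ.freeVar.toList.foldr all φ)) a b ↔ Q := by
    intro L
    induction L with
    | nil => exact hvar _
    | cons q L ih =>
      intro a b
      rw [List.foldr_cons, sat_allPred]
      simp only [ih]
      exact ⟨fun hQ => hQ ∅ Set.countable_empty, fun hQ _ _ => hQ⟩
  exact hpred _ a b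

theorem close_endSentence_mem_iff (hA : ∃ B : AddSubgroup A, IsCountableBase B)
    (φ : ringLanguage.Sentence) :
    (endSentence φ).close ∈ SecondOrderTheory ℵ₀ A ↔ AddMonoid.End A ⊨ φ := by
  have h := sat_close (sat_endSentence hA φ)
  constructor
  · rintro ⟨-, hs⟩
    exact (h (fun _ => 0) fun _ _ => ∅).1 (hs _ _ fun l i => by simp)
  · intro hφ
    exact ⟨isSentence_close _, fun a b _ => (h a b).2 hφ⟩

end SOFormula

theorem theorem3 {A₁ A₂ : Type*} [AddCommGroup A₁] [AddCommGroup A₂]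
    (hred₁ : IsReducedGroup A₁) (hred₂ : IsReducedGroup A₂)
    (hbasic₁ : HasCountableBasicSubgroups A₁) (hbasic₂ : HasCountableBasicSubgroups A₂)
    (hTh : SecondOrderTheory Cardinal.aleph0 A₁ = SecondOrderTheory Cardinal.aleph0 A₂) :
    ringLanguage.ElementarilyEquivalent (AddMonoid.End A₁) (AddMonoid.End A₂) := by
  rw [elementarilyEquivalent_iff]
  intro φ
  rw [← SOFormula.close_endSentence_mem_iff (exists_isCountableBase hred₁ hbasic₁), hTh,
    SOFormula.close_endSentence_mem_iff (exists_isCountableBase hred₂ hbasic₂)]
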